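/- **Theorem.** For $z\in\mathbb F_2^N$ let $|z|$ be its Hamming weight, and for $\epsilon\in(0,\tfrac12)$ let $P_\epsilon(z)=\epsilon^{|z|}(1-\epsilon)^{N-|z|}$ be the distribution of the error string of the binary symmetric channel $\mathrm{BSC}_\epsilon$. For a $t\times N$ matrix $H$ over $\mathbb F_2$ and an integer $k\ge 1$, a $k$-list max-likelihood decoder $D_k$ assigns to every $x\in\mathbb F_2^t$ a set $D_k(x)$ of $k$ distinct strings $z_1,\dots,z_k\in\mathbb F_2^N$ with $Hz_i^{\intercal}=x$ that maximizes $P_\epsilon(z_1)+\dots+P_\epsilon(z_k)$, ties being broken arbitrarily; if fewer than $k$ strings $z$ satisfy $Hz^{\intercal}=x$, then $D_k(x)$ is the set of all of them. Let $\epsilon\in(0,\tfrac12)$, let $N>(5/\epsilon)^{20}$ be an integer, and put $$\tilde\epsilon=\epsilon+N^{-1/4},\qquad \beta=\tfrac12\Bigl(1-2\sqrt{\tilde\epsilon(1-\tilde\epsilon)}\Bigr),\qquad B=\{j\in\mathbb Z:\ \beta N\le j\le(1-\beta)N\}\subseteq\{0,\dots,N\}.$$ Then for every integer $k>1$, every $t\ge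 0$, every $t\times N$ matrix $H$ with entries in $\mathbb F_2$ and every $k$-list max-likelihood decoder $D_k$ for $H$, $$\begin{aligned}\Pr_{\rho\sim P_\epsilon}\bigl[\rho\notin D_k(H\rho^{\intercal})\bigr]\ \le\ & e^{-\frac{\sqrt N}{3\epsilon}}+\sqrt{\frac{3N^{3/4}}{k}}\cdot\max_{j\in B}\sqrt{\Pr_v\bigl[|vH|=j\bigr]\cdot\frac{2^N}{\binom Nj}}\\ &+\sqrt{\frac3k}\cdot 2^{4N^{4/5}}\cdot\sqrt{\frac{N^{7/4}}{\binom{N}{\tilde\epsilon N}}}\cdot\Bigl(\frac{e^2}{\tilde\epsilon}\Bigr)^{\tilde\epsilon N}\cdot\max_{j\in\{0,\dots,N\}\setminus B}\sqrt{\Pr_v\bigl[|vH|=j\bigr]\cdot\Bigl|\frac12-\frac jN\Bigr|^{2\tilde\epsilon N}},\end{aligned}$$ where $v$ is a uniformly random row vector in $\mathbb F_2^t$. If $\tilde\epsilon N$ is not an integer, the inequality holds for both readings $\lfloor\tilde\epsilon N\rfloor$ and $\lceil\tilde\epsilon N\rceil$ of the lower index of the binomial coefficient $\binom{N}{\tilde\epsilon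 N}$; a maximum over the empty set is $0$. -/

import Mathlib

open Finset Matrix

noncomputable section

/-- The probability of the event `A` under a probability mass function `p` on a finite type. -/
def prob {α : Type*} [Fintype α] (p : α → ℝ) (A : α → Prop) : ℝ :=
  open Classical in ∑ a ∈ Finset.univ.filter A, p a

/-- The mass function `P_ε(z) = ε^|z| (1-ε)^(N-|z|)` of the error string of the binary symmetric
channel with crossover probability `ε`; `|z|` is the Hamming weight. -/
def bscMass {N : ℕ} (ε : ℝ) (z : Fin N → ZMod 2) : ℝ :=
  ε ^ hammingNorm z * (1 - ε) ^ (N - hammingNorm z)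

/-- The mass function of the uniform distribution on a finite type. -/
def uniformMass (α : Type*) [Fintype α] (_ : α) : ℝ := 1 / (Fintype.card α : ℝ)

/-- The set of all strings `z` with `H zᵀ = x`. -/
def syndromeFiber {t N : ℕ} (H : Matrix (Fin t) (Fin N) (ZMod 2)) (x : Fin t → ZMod 2) :
    Finset (Fin N → ZMod 2) :=
  Finset.univ.filter fun z => H *ᵥ z = x

/-- The candidate lists for the syndrome `x`: sets of `k` distinct strings with syndrome `x`,
or the set of all strings with syndrome `x` if there are fewer than `k` of them. -/
def candidateLists {t N : ℕ} (k : ℕ) (H : Matrix (Fin t) (Fin N) (ZMod 2)) (x : Fin t → ZMod 2) :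
    Finset (Finset (Fin N → ZMod 2)) :=
  (syndromeFiber H x).powersetCard (min k (syndromeFiber H x).card)

/-- `D` is a `k`-list max-likelihood decoder for the syndromes of `H`: for every `x`, the list `D x`
maximizes `P_ε(z₁) + ⋯ + P_ε(z_k)` among all candidate lists (ties broken arbitrarily). -/
def IsMaxLikelihoodListDecoder {t N : ℕ} (ε : ℝ) (k : ℕ) (H : Matrix (Fin t) (Fin N) (ZMod 2))
    (D : (Fin t → ZMod 2) → Finset (Fin N → ZMod 2)) : Prop :=
  ∀ x, D x ∈ candidateLists k H x ∧
    ∀ L ∈ candidateLists k H x, ∑ z ∈ L, bscMass ε z ≤ ∑ z ∈ D x, bscMass ε z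

/-- `Pr[|v H| = j]` for a uniformly random row vector `v`. -/
def dualWeightProb {t N : ℕ} (H : Matrix (Fin t) (Fin N) (ZMod 2)) (j : ℕ) : ℝ :=
  prob (uniformMass (Fin t → ZMod 2)) fun v => hammingNorm (v ᵥ* H) = j

/-- `ε̃ = ε + N^(-1/4)`. -/
def epsTilde (ε : ℝ) (N : ℕ) : ℝ := ε + (N : ℝ) ^ (-(1 / 4) : ℝ)

/-- `β = (1 - 2 √(ε̃ (1 - ε̃))) / 2`. -/
def betaTilde (ε : ℝ) (N : ℕ) : ℝ :=
  1 / 2 * (1 - 2 * √(epsTilde ε N * (1 - epsTilde ε N)))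

/-- The central weights: the integers `j` with `β N ≤ j ≤ (1 - β) N`. -/
def centralWeights (ε : ℝ) (N : ℕ) : Finset ℕ :=
  open Classical in (Finset.range (N + 1)).filter fun j =>
    betaTilde ε N * N ≤ (j : ℝ) ∧ (j : ℝ) ≤ (1 - betaTilde ε N) * N

/-- The far weights: the `j ∈ {0, …, N}` that are not central. -/
def farWeights (ε : ℝ) (N : ℕ) : Finset ℕ := Finset.range (N + 1) \ centralWeights ε N

/-- `max_{j ∈ S} f j` for a nonnegative function `f`; it is `0` when `S` is empty. -/
def maxOver (S : Finset ℕ) (f : ℕ → ℝ) : ℝ := ⨆ j : S, f j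

end

/-! If the decoder misses `ρ`, an exchange argument puts at least `k` strings of weight at most
`|ρ|` in the syndrome class of `ρ` (`IsMaxLikelihoodListDecoder.le_card`). So `k` times the failure
probability is at most the expected number of such strings. Weights above `ε̃N` are first discarded
by Chernoff's bound (`sum_bscMass_tail_le`); they give the exponential term.

What remains counts pairs of weights `s' ≤ s ≤ ε̃N` with equal syndromes. Fourier duality turns this
count into the average of `K_s(j) K_s'(j)` over the law of `j = |vH|`, with `K` the Krawtchouk
polynomials (`sum_card_sphere_syndrome`).

For central `j`, the law is compared with the binomial one. Parseval and Cauchy–Schwarz then leave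
`√(C(N,s) C(N,s'))`, and the sum over `s, s'` is at most the square of a sum of square roots of
binomial probabilities, hence `3 N^(3/4)` (`sum_sqrt_binomialMass_sq_le`).

For far `j`, outside the oscillatory range of `K_s`, a saddle point bound is sharp enough
(`mass_mul_abs_krawtchouk_le`), and polynomial losses go into the power of 2.

Finally `q ≤ a + b` with `q ≤ 1` yields `q ≤ √a + √b`, whence the square roots in the theorem. -/

/-! ### Characters and Krawtchouk polynomials -/

/-- The nontrivial additive character of `𝔽₂`, with values `±1`. -/
def signChar (a : ZMod 2) : ℝ := if a = 0 then 1 else -1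

/-- The value at `j` of the Krawtchouk polynomial of degree `s`, as the coefficient of `X ^ s`
in `(1 + X) ^ (N - j) * (1 - X) ^ j`. -/
noncomputable def krawtchouk (N s j : ℕ) : ℝ :=
  ((1 + Polynomial.X) ^ (N - j) * (1 - Polynomial.X) ^ j : Polynomial ℝ).coeff s

lemma signChar_zero : signChar 0 = 1 := by simp [signChar]

lemma eq_zero_or_one (a : ZMod 2) : a = 0 ∨ a = 1 := by revert a; decide

lemma signChar_add (a b : ZMod 2) : signChar (a + b) = signChar a * signChar b := by
  have h2 : (1 + 1 : ZMod 2) = 0 := by decide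
  rcases eq_zero_or_one a with rfl | rfl <;> rcases eq_zero_or_one b with rfl | rfl <;>
    simp [signChar, h2]

lemma signChar_sum {ι : Type*} (s : Finset ι) (f : ι → ZMod 2) :
    signChar (∑ i ∈ s, f i) = ∏ i ∈ s, signChar (f i) := by
  classical
  induction s using Finset.induction_on with
  | empty => simp [signChar_zero]
  | insert a s ha ih => rw [Finset.sum_insert ha, Finset.prod_insert ha, signChar_add, ih]

lemma sum_zmod_two {R : Type*} [AddCommMonoid R] (f : ZMod 2 → R) : ∑ b, f b = f 0 + f 1 :=
  Fin.sum_univ_two f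

/-- Characters of `𝔽₂ⁿ` sum to zero unless they are trivial. -/
lemma sum_signChar_dotProduct {n : ℕ} (w : Fin n → ZMod 2) :
    ∑ v : Fin n → ZMod 2, signChar (v ⬝ᵥ w) = if w = 0 then (2 : ℝ) ^ n else 0 := by
  have h1 : ∀ v : Fin n → ZMod 2, signChar (v ⬝ᵥ w) = ∏ i, signChar (v i * w i) := fun v =>
    signChar_sum _ _
  simp_rw [h1]
  rw [← Fintype.prod_sum (fun (i : Fin n) (b : ZMod 2) => signChar (b * w i))]
  have h2 : ∀ i, ∑ b : ZMod 2, signChar (b * w i) = if w i = 0 then (2 : ℝ) else 0 := by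
    intro i
    rw [sum_zmod_two]
    by_cases h : w i = 0
    · simp only [h, mul_zero, signChar_zero, if_true]; norm_num
    · simp [signChar, h]
  simp_rw [h2]
  split_ifs with hw
  · simp [hw]
  · obtain ⟨i, hi⟩ := Function.ne_iff.mp hw
    exact Finset.prod_eq_zero (Finset.mem_univ i) (by simpa using hi)

/-- Both the character and `X ^ |z|` factor over the coordinates, so the signed weight enumerator of
the whole space is a product. -/
lemma sum_signChar_weight_eq_prod {N : ℕ} (u : Fin N → ZMod 2) :
    ∑ z : Fin N → ZMod 2, Polynomial.C (signChar (u ⬝ᵥ z)) * Polynomial.X ^ hammingNorm z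
      = ∏ i, (1 + Polynomial.C (signChar (u i)) * Polynomial.X : Polynomial ℝ) := by
  have h : ∀ z : Fin N → ZMod 2,
      (Polynomial.C (signChar (u ⬝ᵥ z)) * Polynomial.X ^ hammingNorm z : Polynomial ℝ)
        = ∏ i, (if z i = 0 then 1 else Polynomial.C (signChar (u i)) * Polynomial.X) := by
    intro z
    have h1 : (Polynomial.X ^ hammingNorm z : Polynomial ℝ)
        = ∏ i, (if z i = 0 then 1 else Polynomial.X) := by
      rw [hammingNorm, Finset.prod_ite]; simp
    rw [h1, dotProduct, signChar_sum, map_prod, ← Finset.prod_mul_distrib]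
    refine Finset.prod_congr rfl fun i _ => ?_
    split_ifs with hz
    · simp [hz, signChar_zero]
    · simp [(eq_zero_or_one (z i)).resolve_left hz]
  simp_rw [h]
  rw [← Fintype.prod_sum (fun (i : Fin N) (b : ZMod 2) =>
    (if b = 0 then 1 else Polynomial.C (signChar (u i)) * Polynomial.X : Polynomial ℝ))]
  refine Finset.prod_congr rfl fun i _ => ?_
  rw [sum_zmod_two]
  simp

/-- The Krawtchouk polynomial is the Fourier transform of a Hamming sphere. -/
lemma sum_sphere_signChar {N : ℕ} (s : ℕ) (u : Fin N → ZMod 2) :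
    ∑ z : Fin N → ZMod 2 with hammingNorm z = s, signChar (u ⬝ᵥ z)
      = krawtchouk N s (hammingNorm u) := by
  have h1 : ∏ i, (1 + Polynomial.C (signChar (u i)) * Polynomial.X : Polynomial ℝ)
      = (1 + Polynomial.X) ^ (N - hammingNorm u) * (1 - Polynomial.X) ^ hammingNorm u := by
    have h2 : ∀ i, (1 + Polynomial.C (signChar (u i)) * Polynomial.X : Polynomial ℝ)
        = if u i = 0 then 1 + Polynomial.X else 1 - Polynomial.X := by
      intro i
      split_ifs with h
      · simp [h, signChar]
      · simp [h, signChar, sub_eq_add_neg]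
    simp_rw [h2]
    rw [Finset.prod_ite, Finset.prod_const, Finset.prod_const]
    have h3 := Finset.card_filter_add_card_filter_not (s := (Finset.univ : Finset (Fin N)))
      (fun i => u i = 0)
    rw [Finset.card_univ, Fintype.card_fin] at h3
    have h4 : (Finset.univ.filter fun i => ¬ u i = 0).card = hammingNorm u := rfl
    rw [h4] at h3 ⊢
    congr 2
    omega
  rw [krawtchouk, ← h1, ← sum_signChar_weight_eq_prod, Polynomial.finsetSum_coeff,
    Finset.sum_filter]
  refine Finset.sum_congr rfl fun z _ => ?_
  rw [Polynomial.coeff_C_mul, Polynomial.coeff_X_pow]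
  by_cases h : hammingNorm z = s
  · simp [h]
  · simp [h, Ne.symm h]

lemma card_sphere (N s : ℕ) :
    (Finset.univ.filter fun z : Fin N → ZMod 2 => hammingNorm z = s).card = N.choose s := by
  have h := sum_sphere_signChar s (0 : Fin N → ZMod 2)
  simp only [zero_dotProduct, signChar_zero, hammingNorm_zero, krawtchouk, Nat.sub_zero, pow_zero,
    mul_one, Finset.sum_const, nsmul_eq_mul, Polynomial.coeff_one_add_X_pow] at h
  exact_mod_cast h

/-- Sums of functions of the Hamming weight. -/
lemma sum_weight {N : ℕ} (f : ℕ → ℝ) :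
    ∑ z : Fin N → ZMod 2, f (hammingNorm z) = ∑ s ∈ Finset.range (N + 1), N.choose s * f s := by
  have hle : ∀ z : Fin N → ZMod 2, hammingNorm z ∈ Finset.range (N + 1) := fun z => by
    have := hammingNorm_le_card_fintype (x := z)
    rw [Fintype.card_fin] at this
    simpa [Nat.lt_succ_iff] using this
  rw [← Finset.sum_fiberwise_of_maps_to (fun z _ => hle z)]
  refine Finset.sum_congr rfl fun s _ => ?_
  rw [Finset.sum_congr rfl (g := fun _ => f s)
    (fun z hz => by rw [(Finset.mem_filter.mp hz).2]), Finset.sum_const, card_sphere, nsmul_eq_mul]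

/-! ### Duality between equal syndromes and dual weights -/

/-- The pairs of strings of weights `s` and `s'` with equal syndromes, counted on the dual side. -/
lemma sum_krawtchouk_mul {t N : ℕ} (H : Matrix (Fin t) (Fin N) (ZMod 2)) (s s' : ℕ) :
    ∑ v : Fin t → ZMod 2,
        krawtchouk N s (hammingNorm (v ᵥ* H)) * krawtchouk N s' (hammingNorm (v ᵥ* H))
      = (2 : ℝ) ^ t * ∑ z : Fin N → ZMod 2 with hammingNorm z = s,
          ((Finset.univ.filter fun z' : Fin N → ZMod 2 =>
            hammingNorm z' = s' ∧ H *ᵥ z' = H *ᵥ z).card : ℝ) := by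
  simp_rw [← sum_sphere_signChar, Finset.sum_mul_sum]
  rw [Finset.sum_comm, Finset.mul_sum]
  refine Finset.sum_congr rfl fun z _ => ?_
  rw [Finset.sum_comm]
  have h : ∀ z' : Fin N → ZMod 2,
      ∑ v : Fin t → ZMod 2, signChar (v ᵥ* H ⬝ᵥ z) * signChar (v ᵥ* H ⬝ᵥ z')
        = if H *ᵥ z' = H *ᵥ z then (2 : ℝ) ^ t else 0 := by
    intro z'
    have h1 : ∀ v : Fin t → ZMod 2, signChar (v ᵥ* H ⬝ᵥ z) * signChar (v ᵥ* H ⬝ᵥ z')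
        = signChar (v ⬝ᵥ (H *ᵥ z' - H *ᵥ z)) := by
      intro v
      have h2 : H *ᵥ z' - H *ᵥ z = H *ᵥ z + H *ᵥ z' := by
        ext i
        rw [Pi.sub_apply, Pi.add_apply, CharTwo.sub_eq_add, add_comm]
      rw [← signChar_add, ← dotProduct_mulVec, ← dotProduct_mulVec, ← dotProduct_add, h2]
    simp_rw [h1, sum_signChar_dotProduct, sub_eq_zero]
  simp_rw [h]
  rw [← Finset.sum_filter, Finset.sum_const, nsmul_eq_mul, Finset.filter_filter, mul_comm]

/-- Parseval, as the case of the identity matrix in `sum_krawtchouk_mul`: there `vH = v`, and equal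
syndromes force equal strings. -/
lemma sum_choose_mul_krawtchouk_sq (N s : ℕ) :
    ∑ j ∈ Finset.range (N + 1), N.choose j * krawtchouk N s j ^ 2 = 2 ^ N * N.choose s := by
  rw [← sum_weight (fun j => krawtchouk N s j ^ 2)]
  have h := sum_krawtchouk_mul (1 : Matrix (Fin N) (Fin N) (ZMod 2)) s s
  simp only [vecMul_one, one_mulVec, ← pow_two] at h
  rw [h, ← card_sphere, Finset.card_eq_sum_ones, Nat.cast_sum]
  congr 1
  refine Finset.sum_congr rfl fun z hz => ?_
  have : (Finset.univ.filter fun z' : Fin N → ZMod 2 => hammingNorm z' = s ∧ z' = z) = {z} := by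
    ext z'
    simp only [Finset.mem_filter, Finset.mem_univ, true_and, Finset.mem_singleton]
    exact ⟨fun h => h.2, fun h => ⟨h ▸ (Finset.mem_filter.mp hz).2, h⟩⟩
  rw [this]; simp

/-- `∑ⱼ 2⁻ᴺ C(N,j) |K_s(j) K_s'(j)| ≤ √(C(N,s) C(N,s'))`. -/
lemma sum_choose_mul_abs_krawtchouk_le (N s s' : ℕ) :
    ∑ j ∈ Finset.range (N + 1), N.choose j / 2 ^ N * |krawtchouk N s j * krawtchouk N s' j|
      ≤ √((N.choose s : ℝ) * N.choose s') := by
  apply Real.le_sqrt_of_sq_le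
  have hc := Finset.sum_mul_sq_le_sq_mul_sq (Finset.range (N + 1))
    (fun j => √(N.choose j / 2 ^ N : ℝ) * |krawtchouk N s j|)
    (fun j => √(N.choose j / 2 ^ N : ℝ) * |krawtchouk N s' j|)
  have h0 : ∀ j, (0 : ℝ) ≤ N.choose j / 2 ^ N := fun j => by positivity
  have h1 : ∀ s, ∑ j ∈ Finset.range (N + 1), (√(N.choose j / 2 ^ N : ℝ) * |krawtchouk N s j|) ^ 2
      = N.choose s := by
    intro s
    simp_rw [mul_pow, Real.sq_sqrt (h0 _), sq_abs, div_mul_eq_mul_div, ← Finset.sum_div]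
    rw [sum_choose_mul_krawtchouk_sq]
    field_simp
  rw [h1, h1] at hc
  refine le_trans (le_of_eq ?_) hc
  congr 1
  refine Finset.sum_congr rfl fun j _ => ?_
  rw [abs_mul]
  nth_rewrite 1 [← Real.mul_self_sqrt (h0 j)]
  ring

lemma dualWeightProb_nonneg {t N : ℕ} (H : Matrix (Fin t) (Fin N) (ZMod 2)) (j : ℕ) :
    0 ≤ dualWeightProb H j :=
  Finset.sum_nonneg fun _ _ => by unfold uniformMass; positivity

lemma sum_dualWeightProb_mul {t N : ℕ} (H : Matrix (Fin t) (Fin N) (ZMod 2)) (f : ℕ → ℝ) :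
    ∑ j ∈ Finset.range (N + 1), dualWeightProb H j * f j
      = (∑ v : Fin t → ZMod 2, f (hammingNorm (v ᵥ* H))) / 2 ^ t := by
  have hle : ∀ v : Fin t → ZMod 2, hammingNorm (v ᵥ* H) ∈ Finset.range (N + 1) := fun v => by
    have := hammingNorm_le_card_fintype (x := v ᵥ* H)
    rw [Fintype.card_fin] at this
    simpa [Nat.lt_succ_iff] using this
  rw [← Finset.sum_fiberwise_of_maps_to (fun v _ => hle v), Finset.sum_div]
  refine Finset.sum_congr rfl fun j _ => ?_
  rw [Finset.sum_congr rfl (g := fun _ => f j)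
    (fun z hz => by rw [(Finset.mem_filter.mp hz).2])]
  simp only [dualWeightProb, prob, uniformMass, Finset.sum_const, nsmul_eq_mul, Fintype.card_pi,
    ZMod.card, Finset.prod_const, Finset.card_univ, Fintype.card_fin]
  push_cast
  rw [mul_one_div, div_mul_eq_mul_div]
  congr!

/-- The number of pairs of strings of weights `s` and `s'` with equal syndromes, as an average over
the dual weight distribution. -/
lemma sum_card_sphere_syndrome {t N : ℕ} (H : Matrix (Fin t) (Fin N) (ZMod 2)) (s s' : ℕ) :
    ∑ z : Fin N → ZMod 2 with hammingNorm z = s,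
        ((Finset.univ.filter fun z' : Fin N → ZMod 2 =>
          hammingNorm z' = s' ∧ H *ᵥ z' = H *ᵥ z).card : ℝ)
      = ∑ j ∈ Finset.range (N + 1),
          dualWeightProb H j * (krawtchouk N s j * krawtchouk N s' j) := by
  rw [sum_dualWeightProb_mul H (fun j => krawtchouk N s j * krawtchouk N s' j), sum_krawtchouk_mul]
  field_simp

/-! ### Coefficient majorants and the saddle point bound -/

/-- `q` majorizes `p` if its coefficients bound the absolute values of those of `p`. -/
def Majorizes (q p : Polynomial ℝ) : Prop := ∀ i, |p.coeff i| ≤ q.coeff i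

lemma Majorizes.mul {p p' q q' : Polynomial ℝ} (h : Majorizes q p) (h' : Majorizes q' p') :
    Majorizes (q * q') (p * p') := by
  intro i
  rw [Polynomial.coeff_mul, Polynomial.coeff_mul]
  refine (Finset.abs_sum_le_sum_abs _ _).trans (Finset.sum_le_sum fun x _ => ?_)
  rw [abs_mul]
  exact mul_le_mul (h _) (h' _) (abs_nonneg _) ((abs_nonneg _).trans (h _))

lemma Majorizes.pow {p q : Polynomial ℝ} (h : Majorizes q p) (n : ℕ) :
    Majorizes (q ^ n) (p ^ n) := by
  induction n with
  | zero => intro i; simp only [pow_zero, Polynomial.coeff_one]; split_ifs <;> simp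
  | succ n ih => rw [pow_succ, pow_succ]; exact ih.mul h

/-- All terms of the majorant are nonnegative at `r ≥ 0`, so its value there dominates each single
term. -/
lemma Majorizes.abs_coeff_mul_pow_le {p q : Polynomial ℝ} (h : Majorizes q p) (s : ℕ) {r : ℝ}
    (hr : 0 ≤ r) : |p.coeff s| * r ^ s ≤ q.eval r := by
  have h0 : ∀ i, 0 ≤ q.coeff i * r ^ i := fun i =>
    mul_nonneg ((abs_nonneg _).trans (h i)) (pow_nonneg hr i)
  refine (mul_le_mul_of_nonneg_right (h s) (pow_nonneg hr s)).trans ?_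
  rw [Polynomial.eval_eq_sum_range]
  by_cases hs : s ∈ Finset.range (q.natDegree + 1)
  · exact Finset.single_le_sum (f := fun i => q.coeff i * r ^ i) (fun i _ => h0 i) hs
  · rw [Polynomial.coeff_eq_zero_of_natDegree_lt (by simpa using hs), zero_mul]
    exact Finset.sum_nonneg fun i _ => h0 i

lemma majorizes_one_add_X : Majorizes (1 + Polynomial.X) (1 + Polynomial.X) := by
  intro i
  simp only [Polynomial.coeff_add, Polynomial.coeff_one, Polynomial.coeff_X]
  apply le_of_eq; apply abs_of_nonneg; positivity

lemma majorizes_one_sub_X : Majorizes (1 + Polynomial.X) (1 - Polynomial.X) := by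
  intro i
  simp only [Polynomial.coeff_add, Polynomial.coeff_sub, Polynomial.coeff_one, Polynomial.coeff_X]
  refine (abs_sub _ _).trans (le_of_eq ?_)
  congr 1 <;> apply abs_of_nonneg <;> positivity

/-- Cancelling `1 + X` against `1 - X` before taking absolute values gives `1 + X²` instead of `(1 +
X)²`. Each such pair then costs only `exp (r²)`; a factor `exp r` is paid only by the `|N - 2j|`
unpaired factors. -/
lemma majorizes_one_sub_X_sq : Majorizes (1 + Polynomial.X ^ 2) (1 - Polynomial.X ^ 2) := by
  intro i
  simp only [Polynomial.coeff_add, Polynomial.coeff_sub, Polynomial.coeff_one,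
    Polynomial.coeff_X_pow]
  refine (abs_sub _ _).trans (le_of_eq ?_)
  congr 1 <;> apply abs_of_nonneg <;> positivity

lemma pow_mul_pow_le_exp {a b N : ℕ} (hab : 2 * a + b = N) {r : ℝ} (hr : 0 ≤ r) :
    (1 + r ^ 2) ^ a * (1 + r) ^ b ≤ Real.exp (N * r ^ 2 / 2 + b * r) := by
  have h1 : (1 + r ^ 2) ^ a ≤ Real.exp (a * r ^ 2) := by
    rw [Real.exp_nat_mul]
    exact pow_le_pow_left₀ (by positivity) (by linarith [Real.add_one_le_exp (r ^ 2)]) a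
  have h2 : (1 + r) ^ b ≤ Real.exp (b * r) := by
    rw [Real.exp_nat_mul]
    exact pow_le_pow_left₀ (by positivity) (by linarith [Real.add_one_le_exp r]) b
  refine (mul_le_mul h1 h2 (by positivity) (by positivity)).trans ?_
  rw [← Real.exp_add]
  apply Real.exp_le_exp.mpr
  have : (a : ℝ) ≤ N / 2 := by
    have : (2 * a + b : ℝ) = N := by exact_mod_cast hab
    have : (0 : ℝ) ≤ b := by positivity
    linarith
  nlinarith [sq_nonneg r]

/-- A saddle point bound for Krawtchouk polynomials. -/
lemma abs_krawtchouk_mul_pow_le {N j : ℕ} (hj : j ≤ N) (s : ℕ) {r : ℝ} (hr : 0 ≤ r) :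
    |krawtchouk N s j| * r ^ s ≤ Real.exp (N * r ^ 2 / 2 + |(N : ℝ) - 2 * j| * r) := by
  have hX : (1 + Polynomial.X) * (1 - Polynomial.X) = (1 - Polynomial.X ^ 2 : Polynomial ℝ) := by
    ring
  rcases le_total (2 * j) N with h | h
  · have h1 : ((1 + Polynomial.X) ^ (N - j) * (1 - Polynomial.X) ^ j : Polynomial ℝ)
        = (1 - Polynomial.X ^ 2) ^ j * (1 + Polynomial.X) ^ (N - 2 * j) := by
      rw [← hX, mul_pow, show N - j = j + (N - 2 * j) by omega, pow_add]; ring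
    have h2 := ((majorizes_one_sub_X_sq.pow j).mul
      (majorizes_one_add_X.pow (N - 2 * j))).abs_coeff_mul_pow_le s hr
    have h3 : ((N - 2 * j : ℕ) : ℝ) = |(N : ℝ) - 2 * j| := by
      have : (2 * j : ℝ) ≤ N := by exact_mod_cast h
      rw [abs_of_nonneg (by linarith)]; push_cast [h]; ring
    rw [krawtchouk, h1, ← h3]
    refine h2.trans ?_
    simpa using pow_mul_pow_le_exp (show 2 * j + (N - 2 * j) = N by omega) hr
  · have h1 : ((1 + Polynomial.X) ^ (N - j) * (1 - Polynomial.X) ^ j : Polynomial ℝ)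
        = (1 - Polynomial.X ^ 2) ^ (N - j) * (1 - Polynomial.X) ^ (2 * j - N) := by
      nth_rewrite 2 [show j = (N - j) + (2 * j - N) by omega]
      rw [← hX, mul_pow, pow_add]; ring
    have h2 := ((majorizes_one_sub_X_sq.pow (N - j)).mul
      (majorizes_one_sub_X.pow (2 * j - N))).abs_coeff_mul_pow_le s hr
    have h3 : ((2 * j - N : ℕ) : ℝ) = |(N : ℝ) - 2 * j| := by
      have : (N : ℝ) ≤ 2 * j := by exact_mod_cast h
      rw [abs_of_nonpos (by linarith)]; push_cast [h]; ring
    rw [krawtchouk, h1, ← h3]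
    refine h2.trans ?_
    simpa using pow_mul_pow_le_exp (show 2 * (N - j) + (2 * j - N) = N by omega) hr

/-! ### Binomial probabilities -/

/-- The binomial probabilities `C(N,s) ε^s (1-ε)^(N-s)`. -/
noncomputable def binomialMass (ε : ℝ) (N s : ℕ) : ℝ := N.choose s * (ε ^ s * (1 - ε) ^ (N - s))

section Binomial

variable {ε : ℝ}

lemma binomialMass_nonneg (h0 : 0 ≤ ε) (h1 : ε ≤ 1) (N s : ℕ) : 0 ≤ binomialMass ε N s := by
  have : 0 ≤ 1 - ε := by linarith
  unfold binomialMass; positivity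

lemma sum_binomialMass_mul_pow (ε : ℝ) (N : ℕ) (w : ℝ) :
    ∑ s ∈ Finset.range (N + 1), binomialMass ε N s * w ^ s = (ε * w + (1 - ε)) ^ N := by
  rw [add_pow]
  refine Finset.sum_congr rfl fun s _ => ?_
  rw [binomialMass, mul_pow]; ring

lemma sum_binomialMass (ε : ℝ) (N : ℕ) :
    ∑ s ∈ Finset.range (N + 1), binomialMass ε N s = 1 := by
  simpa using sum_binomialMass_mul_pow ε N 1

lemma binomialMass_le_one (h0 : 0 ≤ ε) (h1 : ε ≤ 1) {N s : ℕ} (hs : s ≤ N) :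
    binomialMass ε N s ≤ 1 := by
  rw [← sum_binomialMass ε N]
  exact Finset.single_le_sum (f := binomialMass ε N) (fun i _ => binomialMass_nonneg h0 h1 N i)
    (Finset.mem_range.mpr (by omega))

lemma sum_sq_sub_mul_binomialMass (ε : ℝ) (N : ℕ) :
    ∑ s ∈ Finset.range (N + 1), (N * ε - s) ^ 2 * binomialMass ε N s = N * ε * (1 - ε) := by
  have h := congrArg (Polynomial.eval ε) (bernsteinPolynomial.variance ℝ N)
  rw [Polynomial.eval_finsetSum] at h
  simp only [bernsteinPolynomial, Polynomial.eval_mul, Polynomial.eval_pow, Polynomial.eval_sub,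
    Polynomial.eval_natCast, Polynomial.eval_X, Polynomial.eval_one, nsmul_eq_mul] at h
  rw [← h]
  refine Finset.sum_congr rfl fun s _ => ?_
  rw [binomialMass]; ring

lemma card_filter_abs_sub_le (S : Finset ℕ) {a L : ℝ} (hL : 0 ≤ L) :
    ((S.filter fun s : ℕ => |(s : ℝ) - a| ≤ L).card : ℝ) ≤ 2 * L + 1 := by
  -- The natural floor truncates at 0, so it is at most `a + L` only when `a + L ≥ 0`.
  rcases lt_or_ge (a + L) 0 with hneg | hpos
  · have : (S.filter fun s : ℕ => |(s : ℝ) - a| ≤ L) = ∅ := by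
      refine Finset.filter_false_of_mem fun s _ h => ?_
      have := (abs_le.mp h).2
      have : (0 : ℝ) ≤ s := by positivity
      linarith
    rw [this]; simp; linarith
  · have hsub : (S.filter fun s : ℕ => |(s : ℝ) - a| ≤ L) ⊆ Finset.Icc ⌈a - L⌉₊ ⌊a + L⌋₊ := by
      intro s hs
      have h := abs_le.mp (Finset.mem_filter.mp hs).2
      rw [Finset.mem_Icc]
      exact ⟨Nat.ceil_le.mpr (by linarith), Nat.le_floor (by linarith)⟩
    have h1 := Finset.card_le_card hsub
    rw [Nat.card_Icc] at h1
    have h2 : ((Finset.filter (fun s : ℕ => |(s : ℝ) - a| ≤ L) S).card : ℝ)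
        ≤ ((⌊a + L⌋₊ + 1 - ⌈a - L⌉₊ : ℕ) : ℝ) := by exact_mod_cast h1
    refine h2.trans ?_
    have h3 := Nat.floor_le hpos
    have h4 := Nat.le_ceil (a - L)
    rcases le_total ⌈a - L⌉₊ (⌊a + L⌋₊ + 1) with h | h
    · rw [Nat.cast_sub h]; push_cast; linarith
    · rw [Nat.sub_eq_zero_of_le h]; simp; linarith

lemma sum_sqrt_sq_le (S : Finset ℕ) {f : ℕ → ℝ} (hf : ∀ s, 0 ≤ f s) :
    (∑ s ∈ S, √(f s)) ^ 2 ≤ S.card * ∑ s ∈ S, f s := by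
  have h := Finset.sum_mul_sq_le_sq_mul_sq S (fun _ => (1 : ℝ)) (fun s => √(f s))
  simpa [Real.sq_sqrt (hf _)] using h

/-- The square roots of binomial probabilities have a small sum: at most `√(3 N^(3/4))`. -/
lemma sum_sqrt_binomialMass_sq_le (h0 : 0 < ε) (h1 : ε < 1) {N : ℕ} {c : ℝ} (hc : 100 ≤ c)
    (hcN : c ^ 4 = N) :
    (∑ s ∈ Finset.range (N + 1), √(binomialMass ε N s)) ^ 2 ≤ 3 * c ^ 3 := by
  set P := binomialMass ε N with hP
  have hP0 : ∀ s, 0 ≤ P s := binomialMass_nonneg h0.le h1.le N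
  set R := Finset.range (N + 1)
  -- The window of radius `c³ = N^(3/4)` about the mean: inside, Cauchy–Schwarz costs the number of
  -- terms; outside, Chebyshev leaves mass `1 / (4c²)` for at most `c⁴ + 1` terms.
  set p : ℕ → Prop := fun s : ℕ => |(s : ℝ) - N * ε| ≤ c ^ 3 with hp
  have hsplit := Finset.sum_filter_add_sum_filter_not R p (fun s => √(P s))
  have hc3 : 0 < c ^ 3 := by positivity
  have hA : (∑ s ∈ R.filter p, √(P s)) ^ 2 ≤ 2 * c ^ 3 + 1 := by
    refine (sum_sqrt_sq_le _ hP0).trans ?_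
    have h3 : ∑ s ∈ R.filter p, P s ≤ 1 := by
      rw [← sum_binomialMass ε N]
      exact Finset.sum_le_sum_of_subset_of_nonneg (Finset.filter_subset _ _) fun i _ _ => hP0 i
    calc _ ≤ ((R.filter p).card : ℝ) * 1 := by gcongr
      _ ≤ _ := by rw [mul_one]; exact card_filter_abs_sub_le R hc3.le
  have hB : (∑ s ∈ R.filter (fun s => ¬ p s), √(P s)) ^ 2 ≤ (c ^ 4 + 1) * (1 / (4 * c ^ 2)) := by
    refine (sum_sqrt_sq_le _ hP0).trans ?_
    have h3 : ∑ s ∈ R.filter (fun s => ¬ p s), P s ≤ 1 / (4 * c ^ 2) := by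
      have h4 : c ^ 6 * ∑ s ∈ R.filter (fun s => ¬ p s), P s ≤ c ^ 4 / 4 := by
        calc c ^ 6 * ∑ s ∈ R.filter (fun s => ¬ p s), P s
            ≤ ∑ s ∈ R.filter (fun s => ¬ p s), (N * ε - s) ^ 2 * P s := by
              rw [Finset.mul_sum]
              refine Finset.sum_le_sum fun s hs => ?_
              refine mul_le_mul_of_nonneg_right ?_ (hP0 s)
              have h5 := not_le.mp (Finset.mem_filter.mp hs).2
              rw [show c ^ 6 = (c ^ 3) ^ 2 by ring, ← sq_abs (N * ε - s), abs_sub_comm]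
              exact pow_le_pow_left₀ hc3.le h5.le 2
          _ ≤ ∑ s ∈ R, (N * ε - s) ^ 2 * P s :=
              Finset.sum_le_sum_of_subset_of_nonneg (Finset.filter_subset _ _)
                fun i _ _ => mul_nonneg (sq_nonneg _) (hP0 i)
          _ = N * (ε * (1 - ε)) := by rw [sum_sq_sub_mul_binomialMass]; ring
          _ ≤ c ^ 4 / 4 := by
              rw [← hcN]
              have : 0 ≤ c ^ 4 := by positivity
              nlinarith [sq_nonneg (1 - 2 * ε)]
      rw [le_div_iff₀ (by positivity)]
      have h6 : c ^ 4 * ((∑ s ∈ R.filter (fun s => ¬ p s), P s) * (4 * c ^ 2)) ≤ c ^ 4 * 1 := by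
        nlinarith
      exact le_of_mul_le_mul_left h6 (by positivity)
    have h7 : ((R.filter (fun s => ¬ p s)).card : ℝ) ≤ c ^ 4 + 1 := by
      have := Finset.card_filter_le R (fun s => ¬ p s)
      rw [Finset.card_range] at this
      rw [hcN]; exact_mod_cast this
    exact mul_le_mul h7 h3 (Finset.sum_nonneg fun i _ => hP0 i) (by positivity)
  rw [← hsplit]
  set x := ∑ s ∈ R.filter p, √(P s)
  set y := ∑ s ∈ R.filter (fun s => ¬ p s), √(P s)
  -- The uneven weights keep the main term at `9/8 * 2 c³ < 3 c³`; equal weights would give `4 c³`.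
  have h8 : (x + y) ^ 2 ≤ 9 / 8 * x ^ 2 + 9 * y ^ 2 := by nlinarith [sq_nonneg (x - 8 * y)]
  have h9 : (c ^ 4 + 1) * (1 / (4 * c ^ 2)) ≤ c ^ 2 / 2 := by
    rw [mul_one_div, div_le_iff₀ (by positivity)]
    nlinarith [one_le_pow₀ (n := 4) (show (1 : ℝ) ≤ c by linarith)]
  nlinarith [pow_pos (show 0 < c by linarith) 2, mul_le_mul_of_nonneg_right hc (sq_nonneg c)]

end Binomial

/-! ### The error string of the channel -/

section Channel

variable {ε : ℝ} {N : ℕ}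

lemma bscMass_nonneg (h0 : 0 ≤ ε) (h1 : ε ≤ 1) (z : Fin N → ZMod 2) : 0 ≤ bscMass ε z := by
  have : 0 ≤ 1 - ε := by linarith
  unfold bscMass; positivity

lemma sum_bscMass (ε : ℝ) (N : ℕ) : ∑ z : Fin N → ZMod 2, bscMass ε z = 1 :=
  (sum_weight fun s => ε ^ s * (1 - ε) ^ (N - s)).trans (sum_binomialMass ε N)

lemma hammingNorm_le (z : Fin N → ZMod 2) : hammingNorm z ≤ N := by
  simpa using hammingNorm_le_card_fintype (x := z)

lemma bscMass_lt (h0 : 0 < ε) (h1 : ε < 1 / 2) {z z' : Fin N → ZMod 2}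
    (h : hammingNorm z < hammingNorm z') : bscMass ε z' < bscMass ε z := by
  obtain ⟨d, hd⟩ := Nat.exists_eq_add_of_lt h
  have hN := hammingNorm_le z'
  have h2 : 0 < 1 - ε := by linarith
  have e1 : hammingNorm z' = hammingNorm z + (d + 1) := by omega
  have e2 : N - hammingNorm z = (N - hammingNorm z') + (d + 1) := by omega
  unfold bscMass
  rw [e2, pow_add, e1, pow_add, ← e1]
  have h3 : ε ^ (d + 1) < (1 - ε) ^ (d + 1) :=
    pow_lt_pow_left₀ (by linarith) h0.le (Nat.succ_ne_zero d)
  have h4 : 0 < ε ^ hammingNorm z * (1 - ε) ^ (N - hammingNorm z') := by positivity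
  nlinarith [mul_lt_mul_of_pos_left h3 h4]

/-- Chernoff's bound for the weight of the error string. -/
lemma sum_bscMass_le_exp (h0 : 0 ≤ ε) (h1 : ε ≤ 1) {l : ℝ} (hl : 0 ≤ l) (a : ℝ) :
    ∑ z : Fin N → ZMod 2 with a < hammingNorm z, bscMass ε z
      ≤ Real.exp (N * (ε * (Real.exp l - 1)) - l * a) := by
  have hz : ∀ z : Fin N → ZMod 2, 0 ≤ bscMass ε z * Real.exp (l * (hammingNorm z - a)) :=
    fun z => mul_nonneg (bscMass_nonneg h0 h1 z) (Real.exp_pos _).le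
  calc ∑ z : Fin N → ZMod 2 with a < hammingNorm z, bscMass ε z
      ≤ ∑ z : Fin N → ZMod 2 with a < hammingNorm z,
          bscMass ε z * Real.exp (l * (hammingNorm z - a)) := by
        refine Finset.sum_le_sum fun z hz => ?_
        have := (Finset.mem_filter.mp hz).2
        exact le_mul_of_one_le_right (bscMass_nonneg h0 h1 z)
          (Real.one_le_exp (mul_nonneg hl (by linarith)))
    _ ≤ ∑ z : Fin N → ZMod 2, bscMass ε z * Real.exp (l * (hammingNorm z - a)) :=
        Finset.sum_le_sum_of_subset_of_nonneg (Finset.filter_subset _ _) fun z _ _ => hz z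
    _ = (∑ z : Fin N → ZMod 2, ε ^ hammingNorm z * (1 - ε) ^ (N - hammingNorm z)
          * Real.exp l ^ hammingNorm z) * Real.exp (-(l * a)) := by
        rw [Finset.sum_mul]
        refine Finset.sum_congr rfl fun z _ => ?_
        rw [bscMass, mul_sub, sub_eq_add_neg (l * (hammingNorm z : ℝ)), Real.exp_add, mul_comm l,
          Real.exp_nat_mul]
        ring
    _ = (1 + ε * (Real.exp l - 1)) ^ N * Real.exp (-(l * a)) := by
        rw [sum_weight fun s => ε ^ s * (1 - ε) ^ (N - s) * Real.exp l ^ s]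
        have := sum_binomialMass_mul_pow ε N (Real.exp l)
        simp only [binomialMass, mul_assoc] at this
        simp only [mul_assoc]
        rw [this]; ring
    _ ≤ Real.exp (ε * (Real.exp l - 1)) ^ N * Real.exp (-(l * a)) := by
        have : 0 ≤ ε * (Real.exp l - 1) := mul_nonneg h0 (by linarith [Real.add_one_le_exp l])
        gcongr
        linarith [Real.add_one_le_exp (ε * (Real.exp l - 1))]
    _ = _ := by rw [← Real.exp_nat_mul, ← Real.exp_add]; ring_nf

/-- The Taylor coefficient `1/2` is relaxed to `2/3` to absorb the cubic remainder; the leftover `1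
- 2/3` is the `1/3` in the tail exponent. -/
lemma exp_sub_one_le {l : ℝ} (h0 : 0 ≤ l) (h1 : l ≤ 1 / 2) :
    Real.exp l - 1 ≤ l + 2 / 3 * l ^ 2 := by
  have h := Real.exp_bound' h0 (by linarith) (n := 3) (by norm_num)
  norm_num [Finset.sum_range_succ, Nat.factorial] at h
  nlinarith [mul_nonneg (sq_nonneg l) (show 0 ≤ 1 / 2 - l by linarith)]

/-- Chernoff's bound at `l = 1 / (εc)`, the minimizer of the second-order exponent `ε l² / 2 - l /
c` per symbol. -/
lemma sum_bscMass_tail_le (h0 : 0 < ε) (h1 : ε ≤ 1) {c : ℝ} (hc : 2 ≤ ε * c)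
    (hcN : c ^ 4 = N) :
    ∑ z : Fin N → ZMod 2 with (ε + c⁻¹) * N < hammingNorm z, bscMass ε z
      ≤ Real.exp (-(c ^ 2 / (3 * ε))) := by
  have hc0 : 0 < c := pos_of_mul_pos_right (by linarith) h0.le
  have hl0 : (0 : ℝ) ≤ (ε * c)⁻¹ := by positivity
  have hl1 : (ε * c)⁻¹ ≤ 1 / 2 := by
    rw [inv_eq_one_div]; exact one_div_le_one_div_of_le (by norm_num) hc
  refine (sum_bscMass_le_exp h0.le h1 hl0 _).trans (Real.exp_le_exp.mpr ?_)
  have h2 := exp_sub_one_le hl0 hl1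
  calc N * (ε * (Real.exp (ε * c)⁻¹ - 1)) - (ε * c)⁻¹ * ((ε + c⁻¹) * N)
      ≤ N * (ε * ((ε * c)⁻¹ + 2 / 3 * (ε * c)⁻¹ ^ 2)) - (ε * c)⁻¹ * ((ε + c⁻¹) * N) := by gcongr
    _ = -(c ^ 2 / (3 * ε)) := by rw [← hcN]; field_simp; ring

end Channel

/-! ### List decoding failure and the first moment -/

section Decoder

variable {ε : ℝ} {t N k : ℕ} {H : Matrix (Fin t) (Fin N) (ZMod 2)}
  {D : (Fin t → ZMod 2) → Finset (Fin N → ZMod 2)}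

/-- If the decoder misses the error string `ρ`, at least `k` strings with the same syndrome are at
least as likely. -/
lemma IsMaxLikelihoodListDecoder.le_card (hD : IsMaxLikelihoodListDecoder ε k H D)
    (h0 : 0 < ε) (h1 : ε < 1 / 2) {ρ : Fin N → ZMod 2} (hρ : ρ ∉ D (H *ᵥ ρ)) :
    k ≤ (Finset.univ.filter fun z : Fin N → ZMod 2 =>
      H *ᵥ z = H *ᵥ ρ ∧ hammingNorm z ≤ hammingNorm ρ).card := by
  obtain ⟨hmem, hmax⟩ := hD (H *ᵥ ρ)
  rw [candidateLists, Finset.mem_powersetCard] at hmem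
  obtain ⟨hsub, hcard⟩ := hmem
  have hρF : ρ ∈ syndromeFiber H (H *ᵥ ρ) := by simp [syndromeFiber]
  -- `ρ` lies in the fiber but not in the list, so the list is not the whole fiber and has exactly
  -- `k` elements.
  have hlt : (D (H *ᵥ ρ)).card < (syndromeFiber H (H *ᵥ ρ)).card :=
    Finset.card_lt_card ⟨hsub, fun h => hρ (h hρF)⟩
  have hk : (D (H *ᵥ ρ)).card = k := by omega
  rw [← hk]
  refine Finset.card_le_card fun z hz => ?_
  have hzF : H *ᵥ z = H *ᵥ ρ := (Finset.mem_filter.mp (hsub hz)).2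
  refine Finset.mem_filter.mpr ⟨Finset.mem_univ _, hzF, ?_⟩
  by_contra hlt'
  have hmass := bscMass_lt h0 h1 (not_le.mp hlt')
  have hρe : ρ ∉ (D (H *ᵥ ρ)).erase z := fun h => hρ (Finset.mem_of_mem_erase h)
  -- Exchanging a heavier `z` for `ρ` would increase the total mass of the list.
  have hL := hmax (insert ρ ((D (H *ᵥ ρ)).erase z)) (by
    rw [candidateLists, Finset.mem_powersetCard]
    refine ⟨Finset.insert_subset hρF ((Finset.erase_subset _ _).trans hsub), ?_⟩
    rw [Finset.card_insert_of_notMem hρe, Finset.card_erase_add_one hz, hcard])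
  rw [Finset.sum_insert hρe] at hL
  have := Finset.add_sum_erase _ (bscMass ε) hz
  linarith

/-- A first moment bound for the failure probability on error strings of weight at most `T`, in
terms of the dual weight distribution. -/
lemma IsMaxLikelihoodListDecoder.mul_sum_le (hD : IsMaxLikelihoodListDecoder ε k H D)
    (h0 : 0 < ε) (h1 : ε < 1 / 2) (T : ℝ) :
    k * ∑ ρ : Fin N → ZMod 2 with ((hammingNorm ρ : ℝ) ≤ T ∧ ρ ∉ D (H *ᵥ ρ)), bscMass ε ρ
      ≤ ∑ s ∈ Finset.range (N + 1) with ((s : ℕ) : ℝ) ≤ T, ∑ s' ∈ Finset.range (s + 1),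
          ε ^ s * (1 - ε) ^ (N - s) * ∑ j ∈ Finset.range (N + 1),
            dualWeightProb H j * (krawtchouk N s j * krawtchouk N s' j) := by
  set F : (Fin N → ZMod 2) → ℕ → ℝ := fun ρ s' =>
    ((Finset.univ.filter fun z : Fin N → ZMod 2 =>
      hammingNorm z = s' ∧ H *ᵥ z = H *ᵥ ρ).card : ℝ) with hF
  have hb : ∀ ρ : Fin N → ZMod 2, 0 ≤ bscMass ε ρ := bscMass_nonneg h0.le (by linarith)
  have hcount : ∀ ρ : Fin N → ZMod 2,
      ((Finset.univ.filter fun z : Fin N → ZMod 2 =>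
        H *ᵥ z = H *ᵥ ρ ∧ hammingNorm z ≤ hammingNorm ρ).card : ℝ)
        = ∑ s' ∈ Finset.range (hammingNorm ρ + 1), F ρ s' := by
    intro ρ
    rw [Finset.card_eq_sum_card_fiberwise (f := fun z => hammingNorm z)
      (t := Finset.range (hammingNorm ρ + 1))]
    · rw [Nat.cast_sum]
      refine Finset.sum_congr rfl fun s' hs' => ?_
      rw [hF, Finset.filter_filter]
      congr 2
      ext z
      have := Finset.mem_range.mp hs'
      simp only [Finset.mem_filter, Finset.mem_univ, true_and]
      exact ⟨fun h => ⟨h.2, h.1.1⟩, fun h => ⟨⟨h.2, by omega⟩, h.1⟩⟩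
    · intro z hz
      have := (Finset.mem_filter.mp hz).2.2
      simp only [Finset.coe_range, Set.mem_Iio]
      omega
  calc k * ∑ ρ : Fin N → ZMod 2 with ((hammingNorm ρ : ℝ) ≤ T ∧ ρ ∉ D (H *ᵥ ρ)), bscMass ε ρ
      ≤ ∑ ρ : Fin N → ZMod 2 with ((hammingNorm ρ : ℝ) ≤ T ∧ ρ ∉ D (H *ᵥ ρ)),
          bscMass ε ρ * ∑ s' ∈ Finset.range (hammingNorm ρ + 1), F ρ s' := by
        rw [Finset.mul_sum]
        refine Finset.sum_le_sum fun ρ hρ => ?_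
        rw [mul_comm, ← hcount]
        refine mul_le_mul_of_nonneg_left ?_ (hb ρ)
        exact_mod_cast hD.le_card h0 h1 (Finset.mem_filter.mp hρ).2.2
    _ ≤ ∑ ρ : Fin N → ZMod 2 with (hammingNorm ρ : ℝ) ≤ T,
          bscMass ε ρ * ∑ s' ∈ Finset.range (hammingNorm ρ + 1), F ρ s' := by
        refine Finset.sum_le_sum_of_subset_of_nonneg (fun ρ hρ => ?_) fun ρ _ _ =>
          mul_nonneg (hb ρ) (Finset.sum_nonneg fun _ _ => Nat.cast_nonneg _)
        rw [Finset.mem_filter] at hρ ⊢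
        exact ⟨hρ.1, hρ.2.1⟩
    _ = _ := by
        rw [← Finset.sum_fiberwise_of_maps_to (g := fun ρ => hammingNorm ρ)
          (t := (Finset.range (N + 1)).filter fun s : ℕ => (s : ℝ) ≤ T)]
        · refine Finset.sum_congr rfl fun s hs => ?_
          have hs2 := (Finset.mem_filter.mp hs).2
          simp_rw [← sum_card_sphere_syndrome]
          rw [← Finset.mul_sum, Finset.sum_comm, Finset.mul_sum, Finset.filter_filter]
          refine Finset.sum_congr ?_ fun ρ hρ => ?_
          · ext ρ
            simp only [Finset.mem_filter, Finset.mem_univ, true_and]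
            exact ⟨fun h => h.2, fun h => ⟨h ▸ hs2, h⟩⟩
          · rw [bscMass, (Finset.mem_filter.mp hρ).2]
        · intro ρ hρ
          rw [Finset.mem_filter] at hρ ⊢
          exact ⟨Finset.mem_range.mpr (Nat.lt_succ_of_le (hammingNorm_le ρ)), hρ.2⟩

end Decoder

/-! ### Central and far dual weights -/

lemma le_maxOver {S : Finset ℕ} (f : ℕ → ℝ) {j : ℕ} (hj : j ∈ S) : f j ≤ maxOver S f :=
  le_ciSup (f := fun j : S => f j) (Set.finite_range _).bddAbove ⟨j, hj⟩

lemma maxOver_nonneg (S : Finset ℕ) {f : ℕ → ℝ} (hf : ∀ j, 0 ≤ f j) : 0 ≤ maxOver S f :=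
  Real.iSup_nonneg fun j => hf j

/-- The first moment bound is linear in the quantity under the root, so the maxima of the theorem
enter it squared. -/
lemma le_maxOver_sqrt_sq {S : Finset ℕ} {f : ℕ → ℝ} (hf : ∀ j, 0 ≤ f j) {j : ℕ} (hj : j ∈ S) :
    f j ≤ maxOver S (fun j => √(f j)) ^ 2 := by
  rw [← Real.sq_sqrt (hf j)]
  exact pow_le_pow_left₀ (Real.sqrt_nonneg _) (le_maxOver (fun j => √(f j)) hj) 2

lemma pow_mul_pow_sub_eq {ε : ℝ} (h1 : ε < 1) {N s : ℕ} (hs : s ≤ N) :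
    ε ^ s * (1 - ε) ^ (N - s) = (1 - ε) ^ N * (ε / (1 - ε)) ^ s := by
  have h : 0 < 1 - ε := by linarith
  rw [div_pow, ← Nat.sub_add_cancel hs, pow_add, Nat.add_sub_cancel]
  field_simp

/-- The Krawtchouk polynomials of degree at most `e N` outside of their oscillatory region,
weighted with the mass of a string. -/
lemma mass_mul_abs_krawtchouk_le {ε e : ℝ} (h0 : 0 < ε) (h1 : ε < 1) (he0 : 0 < e)
    (he1 : e ≤ 51 / 100) (heε : e / (4 * (1 - e)) ≤ ε / (1 - ε)) {N s s' j : ℕ} (hN : 0 < N)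
    (hs' : s' ≤ s) (hsN : s ≤ N) (hs : (s : ℝ) ≤ e * N) (hj : j ≤ N)
    (hfar : 2 * N * √(e * (1 - e)) < |(N : ℝ) - 2 * j|) :
    ε ^ s * (1 - ε) ^ (N - s) * |krawtchouk N s j * krawtchouk N s' j|
      ≤ (1 - ε) ^ N * (ε / (1 - ε)) ^ (e * N) * ((Real.exp 2 / e) ^ (e * N)) ^ 2
        * |1 / 2 - (j : ℝ) / N| ^ (2 * e * N) := by
  have hN' : (0 : ℝ) < N := by exact_mod_cast hN
  have h1' : 0 < 1 - ε := by linarith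
  have he1' : 0 < 1 - e := by linarith
  set y := |(N : ℝ) - 2 * j| with hy
  have hy0 : 0 < y := lt_of_le_of_lt (by positivity) hfar
  -- The minimizer of `exp (y r) / r ^ (e N)`, that is, the saddle point with the quadratic term
  -- neglected.
  set r := e * N / y with hr
  have hr0 : 0 < r := by positivity
  have hr2 : r ^ 2 ≤ e / (4 * (1 - e)) := by
    have hsq : (2 * N * √(e * (1 - e))) ^ 2 ≤ y ^ 2 := pow_le_pow_left₀ (by positivity) hfar.le 2
    rw [mul_pow, Real.sq_sqrt (by positivity)] at hsq
    rw [hr, div_pow, div_le_div_iff₀ (by positivity) (by positivity)]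
    nlinarith
  have hr1 : r ≤ 1 := by
    have : e / (4 * (1 - e)) ≤ 1 := by rw [div_le_one (by positivity)]; linarith
    nlinarith
  set q := ε / (1 - ε) with hq
  have hq0 : 0 < q := by positivity
  -- Passing from degrees `s, s'` to `e N` is possible because being far forces `r² ≤ q`, while `r ≤
  -- 1` handles `s' ≤ s`.
  have hqs : q ^ s * r ^ (2 * e * N) ≤ q ^ (e * N) * (r ^ s * r ^ s') := by
    have ha : (r ^ 2) ^ (e * N - s) ≤ q ^ (e * N - s) :=
      Real.rpow_le_rpow (by positivity) (hr2.trans heε) (by linarith)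
    rw [Real.rpow_sub (by positivity), Real.rpow_sub hq0, Real.rpow_natCast, Real.rpow_natCast,
      div_le_div_iff₀ (by positivity) (by positivity)] at ha
    have hb : (r ^ 2) ^ (e * N) = r ^ (2 * e * N) := by
      rw [← Real.rpow_natCast r 2, ← Real.rpow_mul hr0.le]; congr 1; push_cast; ring
    rw [hb, mul_comm] at ha
    refine ha.trans (mul_le_mul_of_nonneg_left ?_ (by positivity))
    rw [← pow_mul, mul_comm 2 s, mul_two, pow_add]
    exact mul_le_mul_of_nonneg_left (pow_le_pow_of_le_one hr0.le hr1 hs') (by positivity)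
  set A := Real.exp (N * r ^ 2 / 2 + y * r) with hA
  have hK : (r ^ s * r ^ s') * |krawtchouk N s j * krawtchouk N s' j| ≤ A * A := by
    have ha := abs_krawtchouk_mul_pow_le hj s hr0.le
    have hb := abs_krawtchouk_mul_pow_le hj s' hr0.le
    rw [abs_mul]
    calc _ = (|krawtchouk N s j| * r ^ s) * (|krawtchouk N s' j| * r ^ s') := by ring
      _ ≤ _ := mul_le_mul ha hb (by positivity) (by positivity)
  have hE : A * A ≤ r ^ (2 * e * N)
      * (((Real.exp 2 / e) ^ (e * N)) ^ 2 * |1 / 2 - (j : ℝ) / N| ^ (2 * e * N)) := by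
    have hw : r * |1 / 2 - (j : ℝ) / N| = e / 2 := by
      have : |1 / 2 - (j : ℝ) / N| = y / (2 * N) := by
        have h2N : |(2 * N : ℝ)| = 2 * N := abs_of_pos (by positivity)
        rw [hy, ← h2N, ← abs_div]
        congr 1; field_simp
      rw [this, hr]; field_simp
    have h2 : ((Real.exp 2 / e) ^ (e * N)) ^ 2 = (Real.exp 2 / e) ^ (2 * e * N) := by
      rw [← Real.rpow_natCast, ← Real.rpow_mul (by positivity)]; congr 1; push_cast; ring
    have h3 : r ^ (2 * e * N)
      * (((Real.exp 2 / e) ^ (e * N)) ^ 2 * |1 / 2 - (j : ℝ) / N| ^ (2 * e * N))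
        = (Real.exp 2 / 2) ^ (2 * e * N) := by
      rw [h2, ← Real.mul_rpow (by positivity) (by positivity),
        ← Real.mul_rpow hr0.le (by positivity)]
      congr 1
      calc _ = Real.exp 2 / e * (r * |1 / 2 - (j : ℝ) / N|) := by ring
        _ = _ := by rw [hw]; field_simp
    -- The summand `13/50` pays for `N r²`: since `e ≤ 51/100`, `r² ≤ e / (4 (1 - e)) ≤ 0.52 e`. The
    -- inequality holds because `1.26 + log 2 < 2`.
    have h4 : Real.exp (1 + 13 / 50) ≤ Real.exp 2 / 2 := by
      rw [le_div_iff₀ two_pos]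
      calc Real.exp (1 + 13 / 50) * 2 = Real.exp (1 + 13 / 50 + Real.log 2) := by
            rw [Real.exp_add _ (Real.log 2), Real.exp_log two_pos]
        _ ≤ _ := Real.exp_le_exp.mpr (by linarith [Real.log_two_lt_d9])
    have h5 : r ^ 2 ≤ 13 / 50 * (2 * e) := by
      refine hr2.trans ?_
      rw [div_le_iff₀ (by positivity)]
      nlinarith
    rw [h3]
    calc A * A = Real.exp (N * r ^ 2 + 2 * e * N) := by
          rw [hA, ← Real.exp_add]
          congr 1
          have : y * r = e * N := by rw [hr]; field_simp
          rw [this]; ring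
      _ ≤ Real.exp ((1 + 13 / 50) * (2 * e * N)) := Real.exp_le_exp.mpr (by nlinarith)
      _ = Real.exp (1 + 13 / 50) ^ (2 * e * N) := Real.exp_mul _ _
      _ ≤ _ := Real.rpow_le_rpow (by positivity) h4 (by positivity)
  set K := |krawtchouk N s j * krawtchouk N s' j| with hKdef
  set B := ((Real.exp 2 / e) ^ (e * N)) ^ 2 * |1 / 2 - (j : ℝ) / N| ^ (2 * e * N)
  have hmain : q ^ s * K ≤ q ^ (e * N) * B := by
    have hrp : 0 < r ^ (2 * e * N) := by positivity
    refine le_of_mul_le_mul_left ?_ hrp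
    calc r ^ (2 * e * N) * (q ^ s * K) = (q ^ s * r ^ (2 * e * N)) * K := by ring
      _ ≤ (q ^ (e * N) * (r ^ s * r ^ s')) * K := by gcongr
      _ = q ^ (e * N) * ((r ^ s * r ^ s') * K) := by ring
      _ ≤ q ^ (e * N) * (r ^ (2 * e * N) * B) := 
          mul_le_mul_of_nonneg_left (hK.trans hE) (by positivity)
      _ = _ := by ring
  calc ε ^ s * (1 - ε) ^ (N - s) * K = (1 - ε) ^ N * (q ^ s * K) := by
        rw [pow_mul_pow_sub_eq h1 hsN]; ring
    _ ≤ (1 - ε) ^ N * (q ^ (e * N) * B) := by gcongr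
    _ = _ := by ring

/-- The mass of a string of weight `a ≈ M` is about `1 / C(N,M)` at most. -/
lemma mass_le_inv_choose {ε : ℝ} (h0 : 0 < ε) (h1 : ε ≤ 1 / 2) {N M : ℕ} (hM : M ≤ N) {a : ℝ}
    (ha : (M : ℝ) - 1 ≤ a) :
    (1 - ε) ^ N * (ε / (1 - ε)) ^ a ≤ 1 / (ε * N.choose M) := by
  have h1' : 0 < 1 - ε := by linarith
  have hC : (0 : ℝ) < N.choose M := by exact_mod_cast Nat.choose_pos hM
  have hq0 : 0 < ε / (1 - ε) := by positivity
  have hq1 : ε / (1 - ε) ≤ 1 := by rw [div_le_one h1']; linarith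
  -- Rounding the exponent costs at most one factor `(1 - ε) / ε`; this is the source of the `1 /
  -- ε`. The rest is a binomial probability, at most 1.
  have h2 := Real.rpow_le_rpow_of_exponent_ge hq0 hq1 ha
  rw [Real.rpow_sub hq0, Real.rpow_natCast, Real.rpow_one] at h2
  have h3 := binomialMass_le_one h0.le (show ε ≤ 1 by linarith) hM
  rw [binomialMass, pow_mul_pow_sub_eq (by linarith) hM] at h3
  rw [le_div_iff₀ (by positivity)]
  calc (1 - ε) ^ N * (ε / (1 - ε)) ^ a * (ε * N.choose M)
      ≤ (1 - ε) ^ N * ((ε / (1 - ε)) ^ M / (ε / (1 - ε))) * (ε * N.choose M) := by gcongr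
    _ = (N.choose M * ((1 - ε) ^ N * (ε / (1 - ε)) ^ M)) * (1 - ε) := by field_simp
    _ ≤ 1 * 1 := mul_le_mul h3 (by linarith) h1'.le zero_le_one
    _ = 1 := one_mul 1

/-- The central weights are those within `N √(ε̃ (1 - ε̃))` of `N / 2`. -/
lemma abs_sub_of_mem_farWeights {ε : ℝ} {N j : ℕ} (hj : j ∈ farWeights ε N) :
    j ≤ N ∧ 2 * N * √(epsTilde ε N * (1 - epsTilde ε N)) < |(N : ℝ) - 2 * j| := by
  rw [farWeights, Finset.mem_sdiff, centralWeights, Finset.mem_filter, Finset.mem_range] at hj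
  obtain ⟨hjN, hj⟩ := hj
  refine ⟨by omega, ?_⟩
  rw [lt_abs]
  by_contra h
  rw [not_or, not_lt, not_lt] at h
  refine hj ⟨hjN, ?_, ?_⟩ <;> unfold betaTilde <;> linarith [h.1, h.2]

/-- The terms of the first moment bound, split into central and far weights. -/
lemma mass_mul_sum_dualWeightProb_le {ε : ℝ} (h0 : 0 < ε) (h1 : ε < 1)
    {t N : ℕ} (H : Matrix (Fin t) (Fin N) (ZMod 2)) (hN : 0 < N) (he0 : 0 < epsTilde ε N)
    (he1 : epsTilde ε N ≤ 51 / 100)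
    (heε : epsTilde ε N / (4 * (1 - epsTilde ε N)) ≤ ε / (1 - ε)) {m m' : ℝ}
    (hm : ∀ j ∈ centralWeights ε N, dualWeightProb H j * ((2 : ℝ) ^ N / (N.choose j : ℝ)) ≤ m)
    (hm0 : 0 ≤ m)
    (hm' : ∀ j ∈ farWeights ε N,
      dualWeightProb H j * |1 / 2 - (j : ℝ) / N| ^ (2 * epsTilde ε N * N) ≤ m') (hm0' : 0 ≤ m')
    {s s' : ℕ} (hs' : s' ≤ s) (hsN : s ≤ N) (hs : (s : ℝ) ≤ epsTilde ε N * N) :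
    ε ^ s * (1 - ε) ^ (N - s) * ∑ j ∈ Finset.range (N + 1),
        dualWeightProb H j * (krawtchouk N s j * krawtchouk N s' j)
      ≤ m * (ε ^ s * (1 - ε) ^ (N - s) * √((N.choose s : ℝ) * N.choose s'))
        + (N + 1) * ((1 - ε) ^ N * (ε / (1 - ε)) ^ (epsTilde ε N * N)
          * ((Real.exp 2 / epsTilde ε N) ^ (epsTilde ε N * N)) ^ 2 * m') := by
  set e := epsTilde ε N
  have h1' : 0 < 1 - ε := by linarith
  have hp : 0 < ε ^ s * (1 - ε) ^ (N - s) := by positivity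
  have hfarsub : farWeights ε N ⊆ Finset.range (N + 1) := Finset.sdiff_subset
  have hcsub : centralWeights ε N ⊆ Finset.range (N + 1) := Finset.filter_subset _ _
  have hd := dualWeightProb_nonneg H
  calc _ ≤ ∑ j ∈ Finset.range (N + 1), dualWeightProb H j
          * (ε ^ s * (1 - ε) ^ (N - s) * |krawtchouk N s j * krawtchouk N s' j|) := by
        rw [Finset.mul_sum]
        refine Finset.sum_le_sum fun j _ => ?_
        rw [mul_left_comm]
        exact mul_le_mul_of_nonneg_left
          (mul_le_mul_of_nonneg_left (le_abs_self _) hp.le) (hd j)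
    _ = ∑ j ∈ centralWeights ε N, dualWeightProb H j
          * (ε ^ s * (1 - ε) ^ (N - s) * |krawtchouk N s j * krawtchouk N s' j|)
        + ∑ j ∈ farWeights ε N, dualWeightProb H j
          * (ε ^ s * (1 - ε) ^ (N - s) * |krawtchouk N s j * krawtchouk N s' j|) := by
        rw [farWeights, add_comm (∑ j ∈ centralWeights ε N, _), Finset.sum_sdiff hcsub]
    _ ≤ _ := by
        refine add_le_add ?_ ?_
        -- The dual law is at most `m` times the binomial law here; absolute values then allow the
        -- sum to be extended to all `j` for Cauchy–Schwarz.
        · calc _ ≤ ∑ j ∈ centralWeights ε N, m * (ε ^ s * (1 - ε) ^ (N - s)) *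
                  (N.choose j / 2 ^ N * |krawtchouk N s j * krawtchouk N s' j|) := by
                refine Finset.sum_le_sum fun j hj => ?_
                have hC : (0 : ℝ) < N.choose j := by
                  exact_mod_cast Nat.choose_pos (Nat.lt_succ_iff.mp (Finset.mem_range.mp (hcsub hj)))
                have hdj : dualWeightProb H j ≤ m * (N.choose j / 2 ^ N) := by
                  have := mul_le_mul_of_nonneg_right (hm j hj)
                    (show (0 : ℝ) ≤ N.choose j / 2 ^ N by positivity)
                  refine le_trans (le_of_eq ?_) this
                  field_simp
                calc _ ≤ m * (N.choose j / 2 ^ N) *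
                      (ε ^ s * (1 - ε) ^ (N - s) * |krawtchouk N s j * krawtchouk N s' j|) := by
                      gcongr
                  _ = _ := by ring
            _ ≤ ∑ j ∈ Finset.range (N + 1), m * (ε ^ s * (1 - ε) ^ (N - s)) *
                  (N.choose j / 2 ^ N * |krawtchouk N s j * krawtchouk N s' j|) :=
                Finset.sum_le_sum_of_subset_of_nonneg hcsub fun j _ _ => by positivity
            _ ≤ m * (ε ^ s * (1 - ε) ^ (N - s)) * √((N.choose s : ℝ) * N.choose s') := by
                rw [← Finset.mul_sum]
                exact mul_le_mul_of_nonneg_left (sum_choose_mul_abs_krawtchouk_le N s s')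
                  (by positivity)
            _ = _ := by ring
        · calc _ ≤ ∑ j ∈ farWeights ε N, (1 - ε) ^ N * (ε / (1 - ε)) ^ (e * N)
                  * ((Real.exp 2 / e) ^ (e * N)) ^ 2 * m' := by
                refine Finset.sum_le_sum fun j hj => ?_
                obtain ⟨hjN, hjf⟩ := abs_sub_of_mem_farWeights hj
                have h3 := mass_mul_abs_krawtchouk_le h0 h1 he0 he1 heε hN hs' hsN hs hjN hjf
                calc _ ≤ dualWeightProb H j * ((1 - ε) ^ N * (ε / (1 - ε)) ^ (e * N)
                      * ((Real.exp 2 / e) ^ (e * N)) ^ 2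
                        * |1 / 2 - (j : ℝ) / N| ^ (2 * e * N)) :=
                      mul_le_mul_of_nonneg_left h3 (hd j)
                  _ = (1 - ε) ^ N * (ε / (1 - ε)) ^ (e * N) * ((Real.exp 2 / e) ^ (e * N)) ^ 2
                      * (dualWeightProb H j * |1 / 2 - (j : ℝ) / N| ^ (2 * e * N)) := by ring
                  _ ≤ _ := mul_le_mul_of_nonneg_left (hm' j hj) (by positivity)
            _ ≤ _ := by
                rw [Finset.sum_const, nsmul_eq_mul]
                refine mul_le_mul_of_nonneg_right ?_ (by positivity)
                have := Finset.card_le_card hfarsub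
                rw [Finset.card_range] at this
                exact_mod_cast this

/-- Pairs of weights contribute at most the square of the sum of the square roots of the
binomial probabilities. -/
lemma sum_mass_mul_sqrt_le {ε : ℝ} (h0 : 0 < ε) (h1 : ε < 1 / 2) (N : ℕ) (p : ℕ → Prop)
    [DecidablePred p] :
    ∑ s ∈ Finset.range (N + 1) with p s, ∑ s' ∈ Finset.range (s + 1),
        ε ^ s * (1 - ε) ^ (N - s) * √((N.choose s : ℝ) * N.choose s')
      ≤ (∑ s ∈ Finset.range (N + 1), √(binomialMass ε N s)) ^ 2 := by
  have h1' : 0 < 1 - ε := by linarith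
  have hq0 : 0 < ε / (1 - ε) := by positivity
  have hq1 : ε / (1 - ε) ≤ 1 := by rw [div_le_one h1']; linarith
  rw [pow_two, Finset.sum_mul_sum]
  calc _ ≤ ∑ s ∈ Finset.range (N + 1) with p s, ∑ s' ∈ Finset.range (s + 1),
        √(binomialMass ε N s) * √(binomialMass ε N s') := by
        refine Finset.sum_le_sum fun s hs => Finset.sum_le_sum fun s' hs' => ?_
        have hsN : s ≤ N := Nat.lt_succ_iff.mp (Finset.mem_range.mp (Finset.mem_filter.mp hs).1)
        have hss : s' ≤ s := Nat.lt_succ_iff.mp (Finset.mem_range.mp hs')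
        -- The lighter string is the likelier one, so one of the two mass factors in the square may
        -- be moved to `s'`.
        have hle : ε ^ s * (1 - ε) ^ (N - s) ≤ ε ^ s' * (1 - ε) ^ (N - s') := by
          rw [pow_mul_pow_sub_eq (by linarith) hsN, pow_mul_pow_sub_eq (by linarith) (hss.trans hsN)]
          exact mul_le_mul_of_nonneg_left (pow_le_pow_of_le_one hq0.le hq1 hss) (by positivity)
        have hp : 0 < ε ^ s * (1 - ε) ^ (N - s) := by positivity
        rw [← Real.sqrt_mul (binomialMass_nonneg h0.le (by linarith) N s)]
        apply Real.le_sqrt_of_sq_le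
        rw [mul_pow, Real.sq_sqrt (by positivity), binomialMass, binomialMass]
        calc _ = (ε ^ s * (1 - ε) ^ (N - s)) * (ε ^ s * (1 - ε) ^ (N - s))
              * (N.choose s * N.choose s') := by ring
          _ ≤ (ε ^ s * (1 - ε) ^ (N - s)) * (ε ^ s' * (1 - ε) ^ (N - s'))
              * (N.choose s * N.choose s') := by gcongr
          _ = _ := by ring
    _ ≤ ∑ s ∈ Finset.range (N + 1) with p s, ∑ s' ∈ Finset.range (N + 1),
        √(binomialMass ε N s) * √(binomialMass ε N s') := by
        refine Finset.sum_le_sum fun s hs => ?_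
        have hsN := Finset.mem_range.mp (Finset.mem_filter.mp hs).1
        exact Finset.sum_le_sum_of_subset_of_nonneg (Finset.range_mono (by omega))
          fun _ _ _ => by positivity
    _ ≤ _ := Finset.sum_le_sum_of_subset_of_nonneg (Finset.filter_subset _ _)
        fun _ _ _ => Finset.sum_nonneg fun _ _ => by positivity

lemma sum_range_filter_const_le (N : ℕ) (p : ℕ → Prop) [DecidablePred p] {a : ℝ} (ha : 0 ≤ a) :
    ∑ s ∈ Finset.range (N + 1) with p s, ∑ _s' ∈ Finset.range (s + 1), a
      ≤ (N + 1) * ((N + 1) * a) := by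
  calc _ ≤ ∑ s ∈ Finset.range (N + 1) with p s, (N + 1) * a := by
        refine Finset.sum_le_sum fun s hs => ?_
        have hsN := Finset.mem_range.mp (Finset.mem_filter.mp hs).1
        rw [Finset.sum_const, Finset.card_range, nsmul_eq_mul]
        refine mul_le_mul_of_nonneg_right ?_ ha
        exact_mod_cast hsN
    _ ≤ _ := by
        rw [Finset.sum_const, nsmul_eq_mul]
        refine mul_le_mul_of_nonneg_right ?_ (by positivity)
        have := Finset.card_filter_le (Finset.range (N + 1)) p
        rw [Finset.card_range] at this
        exact_mod_cast this

/-! ### Numerical estimates and conclusion -/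

/-- The numerical facts about `c = N^(1/4)` when `N > (5/ε)^20`. -/
lemma fourth_root_bounds {ε c : ℝ} (h0 : 0 < ε) (h1 : ε < 1 / 2) (hc0 : 0 < c)
    (hc : (5 / ε) ^ 20 < c ^ 4) : 100 ≤ c ∧ 100 ≤ ε * c ∧ c⁻¹ ≤ ε / 100 := by
  have h2 : (5 / ε) ^ 5 < c := by
    refine lt_of_pow_lt_pow_left₀ 4 hc0.le ?_
    rwa [← pow_mul]
  rw [div_pow, div_lt_iff₀ (by positivity)] at h2
  have h3 : ε ^ 4 ≤ 1 := pow_le_one₀ h0.le (by linarith)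
  have h4 : c * ε ^ 5 ≤ ε * c := by
    have : 0 < ε * c := by positivity
    calc c * ε ^ 5 = (ε * c) * ε ^ 4 := by ring
      _ ≤ _ := mul_le_of_le_one_right this.le h3
  have h5 : 100 ≤ ε * c := by norm_num at h2; linarith
  refine ⟨by nlinarith, h5, ?_⟩
  rw [inv_le_iff_one_le_mul₀ hc0]
  linarith

/-- Polynomial factors are absorbed by `2^(8 N^(4/5))`. -/
lemma polynomial_factor_le {ε c x : ℝ} (h0 : 0 < ε) (hc : 100 ≤ c) (hεc : 1 ≤ ε * c)
    (hx : c ^ 3 ≤ x) :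
    (c ^ 4 + 1) * ((c ^ 4 + 1) * (c ^ 4 + 1)) * (1 / ε) ≤ 3 * ((2 : ℝ) ^ (4 * x)) ^ 2 * c ^ 7 := by
  have hc0 : 0 < c := by linarith
  have hc1 : 1 ≤ c := by linarith
  have hx1 : 1 ≤ x := (one_le_pow₀ hc1).trans hx
  -- Bernoulli's inequality; its eighth power `c ^ 24` already exceeds what is needed.
  have h1 : c ^ 3 ≤ (2 : ℝ) ^ x := by
    have := one_add_mul_self_le_rpow_one_add (show (-1 : ℝ) ≤ 1 by norm_num) hx1
    norm_num at this
    linarith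
  have h2 : (2 : ℝ) ^ (4 * x) = ((2 : ℝ) ^ x) ^ 4 := by
    rw [mul_comm, Real.rpow_mul two_pos.le]; norm_cast
  have h3 : (c ^ 3) ^ 8 ≤ ((2 : ℝ) ^ (4 * x)) ^ 2 := by
    rw [h2, ← pow_mul _ 4 2]; exact pow_le_pow_left₀ (by positivity) h1 8
  have h4 : 1 / ε ≤ c := by rw [div_le_iff₀ h0]; linarith
  have h5 : c ^ 4 + 1 ≤ 2 * c ^ 4 := by linarith [one_le_pow₀ hc1 (n := 4)]
  calc (c ^ 4 + 1) * ((c ^ 4 + 1) * (c ^ 4 + 1)) * (1 / ε)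
      ≤ (2 * c ^ 4) * ((2 * c ^ 4) * (2 * c ^ 4)) * c := by gcongr
    _ = (8 * c ^ 13) * 1 := by ring
    _ ≤ (8 * c ^ 13) * (3 / 8 * c ^ 18) := by
        gcongr
        have : c ≤ c ^ 18 := le_self_pow₀ hc1 (by norm_num)
        linarith
    _ = 3 * (c ^ 3) ^ 8 * c ^ 7 := by ring
    _ ≤ _ := by gcongr

/-- On `[0, 1]` one has `q ≤ √q`, and the square root is subadditive. -/
lemma le_sqrt_add_sqrt {q a b : ℝ} (h0 : 0 ≤ q) (h1 : q ≤ 1) (hb : 0 ≤ b)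
    (ha : 0 ≤ a) (h : q ≤ a + b) : q ≤ √a + √b := by
  calc q ≤ √(a + b) := Real.le_sqrt_of_sq_le (by nlinarith)
    _ ≤ √a + √b := by
        rw [Real.sqrt_le_left (by positivity)]
        nlinarith [Real.sq_sqrt ha, Real.sq_sqrt hb,
          mul_nonneg (Real.sqrt_nonneg a) (Real.sqrt_nonneg b)]

theorem mainTheorem7 (ε : ℝ) (hε0 : 0 < ε) (hε1 : ε < 1 / 2)
    (N : ℕ) (hN : (5 / ε) ^ 20 < (N : ℝ)) (k : ℕ) (hk : 1 < k)
    (t : ℕ) (H : Matrix (Fin t) (Fin N) (ZMod 2))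
    (D : (Fin t → ZMod 2) → Finset (Fin N → ZMod 2))
    (hD : IsMaxLikelihoodListDecoder ε k H D)
    (M : ℕ) (hM : |(M : ℝ) - epsTilde ε N * N| < 1) :
    prob (bscMass ε) (fun ρ : Fin N → ZMod 2 => ρ ∉ D (H *ᵥ ρ)) ≤
      Real.exp (-(√(N : ℝ) / (3 * ε)))
      + √(3 * (N : ℝ) ^ (3 / 4 : ℝ) / k)
        * maxOver (centralWeights ε N)
            (fun j => √(dualWeightProb H j * ((2 : ℝ) ^ N / (N.choose j : ℝ))))
      + √(3 / (k : ℝ)) * (2 : ℝ) ^ (4 * (N : ℝ) ^ (4 / 5 : ℝ))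
        * √((N : ℝ) ^ (7 / 4 : ℝ) / (N.choose M : ℝ))
        * (Real.exp 2 / epsTilde ε N) ^ (epsTilde ε N * N)
        * maxOver (farWeights ε N)
            (fun j => √(dualWeightProb H j
              * |1 / 2 - (j : ℝ) / N| ^ (2 * epsTilde ε N * N))) := by
  have hN0 : (0 : ℝ) < N := lt_trans (by positivity) hN
  have hk0 : (0 : ℝ) < k := by exact_mod_cast (by omega : 0 < k)
  obtain ⟨c, hcdef⟩ : ∃ c, c = (N : ℝ) ^ (1 / 4 : ℝ) := ⟨_, rfl⟩
  have hc0 : 0 < c := by rw [hcdef]; positivity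
  have hcpow : ∀ n : ℕ, (N : ℝ) ^ ((n : ℝ) / 4) = c ^ n := fun n => by
    rw [hcdef, ← Real.rpow_natCast, ← Real.rpow_mul hN0.le]; congr 1; ring
  have hcN : c ^ 4 = N := by rw [← hcpow]; norm_num
  have hc3 : (N : ℝ) ^ (3 / 4 : ℝ) = c ^ 3 := by exact_mod_cast hcpow 3
  have hc7 : (N : ℝ) ^ (7 / 4 : ℝ) = c ^ 7 := by exact_mod_cast hcpow 7
  have hsqrt : √(N : ℝ) = c ^ 2 := by
    rw [← hcN, show c ^ 4 = (c ^ 2) ^ 2 by ring]; exact Real.sqrt_sq (by positivity)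
  obtain ⟨hc, hεc, hcε⟩ := fourth_root_bounds hε0 hε1 hc0 (by rwa [hcN])
  have he : epsTilde ε N = ε + c⁻¹ := by
    rw [epsTilde, hcdef, ← Real.rpow_neg hN0.le]
  have hinv : 0 < c⁻¹ := inv_pos.mpr hc0
  have he0 : 0 < epsTilde ε N := by rw [he]; positivity
  have he1 : epsTilde ε N ≤ 51 / 100 := by rw [he]; linarith
  -- `ε̃ ≤ 1.01 ε`, so the factor 4 leaves ample room; this supplies `r² ≤ ε / (1 - ε)` for far
  -- weights.
  have heε : epsTilde ε N / (4 * (1 - epsTilde ε N)) ≤ ε / (1 - ε) := by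
    have : epsTilde ε N ≤ 101 / 100 * ε := by rw [he]; linarith
    rw [div_le_div_iff₀ (by linarith) (by linarith)]
    nlinarith
  have hNc : (100 : ℝ) ≤ N := by
    rw [← hcN]; exact hc.trans (le_self_pow₀ (by linarith) (by norm_num))
  have hMN : M ≤ N := by
    have h1 := (abs_lt.mp hM).2
    have h2 : epsTilde ε N * N ≤ 51 / 100 * N := mul_le_mul_of_nonneg_right he1 hN0.le
    exact_mod_cast (by linarith : (M : ℝ) ≤ N)
  have hx : c ^ 3 ≤ (N : ℝ) ^ (4 / 5 : ℝ) := by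
    rw [← hc3]; exact Real.rpow_le_rpow_of_exponent_le (by linarith) (by norm_num)
  have hC : (0 : ℝ) < N.choose M := by exact_mod_cast Nat.choose_pos hMN
  set m := maxOver (centralWeights ε N)
    (fun j => √(dualWeightProb H j * ((2 : ℝ) ^ N / (N.choose j : ℝ)))) with hm
  set m' := maxOver (farWeights ε N)
    (fun j => √(dualWeightProb H j * |1 / 2 - (j : ℝ) / N| ^ (2 * epsTilde ε N * N))) with hm'
  have hm0 : 0 ≤ m := maxOver_nonneg _ fun _ => Real.sqrt_nonneg _
  have hm0' : 0 ≤ m' := maxOver_nonneg _ fun _ => Real.sqrt_nonneg _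
  set e := epsTilde ε N with hedef
  set E := (Real.exp 2 / e) ^ (e * N) with hE
  have hE0 : 0 < E := by positivity
  have hb : ∀ ρ : Fin N → ZMod 2, 0 ≤ bscMass ε ρ := bscMass_nonneg hε0.le (by linarith)
  set q := ∑ ρ : Fin N → ZMod 2 with ((hammingNorm ρ : ℝ) ≤ e * N ∧ ρ ∉ D (H *ᵥ ρ)), bscMass ε ρ
    with hq
  have hq0 : 0 ≤ q := Finset.sum_nonneg fun ρ _ => hb ρ
  have hq1 : q ≤ 1 := by
    rw [← sum_bscMass ε N]
    exact Finset.sum_le_sum_of_subset_of_nonneg (Finset.filter_subset _ _) fun ρ _ _ => hb ρ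
  have hsplit : prob (bscMass ε) (fun ρ : Fin N → ZMod 2 => ρ ∉ D (H *ᵥ ρ))
      ≤ Real.exp (-(√(N : ℝ) / (3 * ε))) + q := by
    have htail := sum_bscMass_tail_le (N := N) hε0 (by linarith) (by linarith : 2 ≤ ε * c) hcN
    rw [← he] at htail
    rw [hsqrt]
    refine le_trans ?_ (add_le_add_left htail q)
    rw [hq, prob, Finset.sum_filter, Finset.sum_filter, Finset.sum_filter,
      ← Finset.sum_add_distrib]
    refine Finset.sum_le_sum fun ρ _ => ?_
    have := hb ρ
    by_cases h1 : ρ ∉ D (H *ᵥ ρ)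
    · rcases lt_or_ge (e * N) (hammingNorm ρ : ℝ) with h2 | h2
      · simp [h1, h2, not_le.mpr h2]
      · simp [h1, h2, not_lt.mpr h2]
    · simp only [h1, and_false, if_false, add_zero]
      split_ifs <;> linarith
  set p := (1 - ε) ^ N * (ε / (1 - ε)) ^ (e * N) with hp
  have hp0 : 0 < p := by
    have : 0 < 1 - ε := by linarith
    positivity
  have hmoment : k * q ≤ m ^ 2 * (3 * c ^ 3)
      + (N + 1) * ((N + 1) * ((N + 1) * (p * E ^ 2 * m' ^ 2))) := by
    calc k * q ≤ _ := hD.mul_sum_le hε0 hε1 (e * N)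
      _ ≤ ∑ s ∈ Finset.range (N + 1) with ((s : ℕ) : ℝ) ≤ e * N, ∑ s' ∈ Finset.range (s + 1),
          (m ^ 2 * (ε ^ s * (1 - ε) ^ (N - s) * √((N.choose s : ℝ) * N.choose s'))
            + (N + 1) * (p * E ^ 2 * m' ^ 2)) := by
          refine Finset.sum_le_sum fun s hs => Finset.sum_le_sum fun s' hs' => ?_
          rw [Finset.mem_filter, Finset.mem_range] at hs
          rw [Finset.mem_range] at hs'
          exact mass_mul_sum_dualWeightProb_le hε0 (by linarith) H (by exact_mod_cast hN0) he0 he1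
            heε
            (fun j hj => le_maxOver_sqrt_sq
              (f := fun j : ℕ => dualWeightProb H j * ((2 : ℝ) ^ N / (N.choose j : ℝ)))
              (fun j => mul_nonneg (dualWeightProb_nonneg H j) (by positivity)) hj)
            (sq_nonneg m)
            (fun j hj => le_maxOver_sqrt_sq
              (f := fun j : ℕ => dualWeightProb H j * |1 / 2 - (j : ℝ) / N| ^ (2 * e * N))
              (fun j => mul_nonneg (dualWeightProb_nonneg H j) (by positivity)) hj)
            (sq_nonneg m') (by omega) (by omega) hs.2
      _ = m ^ 2 * ∑ s ∈ Finset.range (N + 1) with ((s : ℕ) : ℝ) ≤ e * N,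
            ∑ s' ∈ Finset.range (s + 1),
              ε ^ s * (1 - ε) ^ (N - s) * √((N.choose s : ℝ) * N.choose s')
          + ∑ s ∈ Finset.range (N + 1) with ((s : ℕ) : ℝ) ≤ e * N,
            ∑ s' ∈ Finset.range (s + 1), (N + 1) * (p * E ^ 2 * m' ^ 2) := by
          simp_rw [Finset.sum_add_distrib, Finset.mul_sum]
      _ ≤ _ := by
          refine add_le_add (mul_le_mul_of_nonneg_left ?_ (sq_nonneg m)) ?_
          · exact (sum_mass_mul_sqrt_le hε0 hε1 N _).trans
              (sum_sqrt_binomialMass_sq_le hε0 (by linarith) hc hcN)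
          · exact sum_range_filter_const_le N _ (by positivity)
  set x := (N : ℝ) ^ (4 / 5 : ℝ)
  have hfar : (N + 1) * ((N + 1) * ((N + 1) * (p * E ^ 2 * m' ^ 2)))
      ≤ 3 * ((2 : ℝ) ^ (4 * x)) ^ 2 * (c ^ 7 / N.choose M) * E ^ 2 * m' ^ 2 := by
    -- Only `M - 1 ≤ ε̃N` is needed, which covers both roundings.
    have hpM : p ≤ 1 / (ε * N.choose M) :=
      mass_le_inv_choose hε0 hε1.le hMN (by linarith [(abs_lt.mp hM).2])
    have h1 := polynomial_factor_le hε0 hc (by linarith) hx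
    rw [hcN] at h1
    calc _ = ((N + 1) * ((N + 1) * (N + 1))) * p * (E ^ 2 * m' ^ 2) := by ring
      _ ≤ ((N + 1) * ((N + 1) * (N + 1))) * (1 / (ε * N.choose M)) * (E ^ 2 * m' ^ 2) := by gcongr
      _ = ((N + 1) * ((N + 1) * (N + 1)) * (1 / ε)) * (1 / N.choose M * (E ^ 2 * m' ^ 2)) := by
          field_simp
      _ ≤ (3 * ((2 : ℝ) ^ (4 * x)) ^ 2 * c ^ 7) * (1 / N.choose M * (E ^ 2 * m' ^ 2)) := by gcongr
      _ = _ := by ring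
  have hqle : q ≤ 3 * c ^ 3 / k * m ^ 2
      + 3 / k * ((2 : ℝ) ^ (4 * x)) ^ 2 * (c ^ 7 / N.choose M) * E ^ 2 * m' ^ 2 := by
    refine le_of_mul_le_mul_left ((hmoment.trans (add_le_add_right hfar _)).trans (le_of_eq ?_)) hk0
    field_simp
  have hfinal := le_sqrt_add_sqrt hq0 hq1 (by positivity) (by positivity) hqle
  rw [Real.sqrt_mul (by positivity) (m ^ 2), Real.sqrt_sq hm0, Real.sqrt_mul (by positivity)
    (m' ^ 2), Real.sqrt_sq hm0', Real.sqrt_mul (by positivity) (E ^ 2), Real.sqrt_sq hE0.le,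
    Real.sqrt_mul (by positivity) (c ^ 7 / _), Real.sqrt_mul (by positivity) (_ ^ 2),
    Real.sqrt_sq (by positivity)] at hfinal
  rw [hc3, hc7]
  linarith
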